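/- Let $\widehat{\mathrm{Diff}}_{\mathrm{fib}}$ denote the group of formal diffeomorphisms $\Phi$ of $(\mathbb{C}^3,0)$, with coordinates $(x,y_1,y_2)$, that are fibered in $x$: $\Phi(x,y_1,y_2)=(x,\phi(x,y_1,y_2))$, where the components of $\Phi$ lie in $\mathbb{C}[[x,y_1,y_2]]$ and have no constant term, and the Jacobian matrix of $\Phi$ at $0$ is invertible. For a formal vector field $X$ on $(\mathbb{C}^3,0)$ put $\Phi_*(X)=(\mathrm{D}\Phi\cdot X)\circ\Phi^{-1}$ and $$\widehat{\mathrm{Isot}}_{\mathrm{fib}}(X)=\{\Phi\in\widehat{\mathrm{Diff}}_{\mathrm{fib}} \mid \Phi_*(X)=X\}.$$ Let $\lambda,a_1,a_2\in\mathbb{C}$ and $c_1,c_2\in v\,\mathbb{C}[[v]]$ be such that $\lambda\neq 0$ and $a_1+a_2\notin\mathbb{Q}_{\le 0}$, and consider the normal form $$Z=x^2\frac{\partial}{\partial x}+\bigl(-\lambda+a_1x+c_1(y_1y_2)\bigr)y_1\frac{\partial}{\partial y_1}+\bigl(\lambda+a_2x+c_2(y_1y_2)\bigr)y_2\frac{\partial}{\partial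 y_2}.$$ Then $$\widehat{\mathrm{Isot}}_{\mathrm{fib}}(Z)=\bigl\{\mathrm{diag}(1,\theta_1,\theta_2)\ \bigm|\ (\theta_1,\theta_2)\in(\mathbb{C}^*)^2,\ c_i(\theta_1\theta_2v)=c_i(v)\text{ in }\mathbb{C}[[v]]\text{ for } i=1,2\bigr\},$$ where $\mathrm{diag}(1,\theta_1,\theta_2)$ is the linear map $(x,y_1,y_2)\mapsto(x,\theta_1y_1,\theta_2y_2)$. -/

import Mathlib

noncomputable section

namespace DoublyResonant

open MvPowerSeries

/-- Formal power series `ℂ⟦x, y₁, y₂⟧`; the variables are `X 0 = x`, `X 1 = y₁`, `X 2 = y₂`. -/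
abbrev Series : Type := MvPowerSeries (Fin 3) ℂ

/-- A formal vector field `b ∂/∂x + b₁ ∂/∂y₁ + b₂ ∂/∂y₂`, given by its components
`![b, b₁, b₂]`. -/
abbrev VectorField : Type := Fin 3 → Series

/-- A formal self-map of `ℂ³` fixing the origin: a triple of power series without
constant terms. -/
@[ext]
structure FormalMap where
  toFun : Fin 3 → Series
  constantCoeff_eq_zero : ∀ i, constantCoeff (toFun i) = 0

namespace FormalMap

instance : CoeFun FormalMap (fun _ => Fin 3 → Series) := ⟨FormalMap.toFun⟩

theorem hasSubst (Φ : FormalMap) : HasSubst Φ.toFun :=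
  hasSubst_of_constantCoeff_zero Φ.constantCoeff_eq_zero

/-- The product is the composition `Φ * Ψ = Φ ∘ Ψ`: `Ψ` is substituted into the components
of `Φ`; the unit is the identity `(x, y₁, y₂)`. -/
instance : Monoid FormalMap where
  mul Φ Ψ := ⟨fun i => subst Ψ.toFun (Φ.toFun i), fun i =>
    constantCoeff_subst_eq_zero Ψ.hasSubst Ψ.constantCoeff_eq_zero (Φ.constantCoeff_eq_zero i)⟩
  one := ⟨fun i => X i, fun i => constantCoeff_X i⟩
  mul_assoc Φ Ψ Θ := by
    ext1
    funext i
    exact subst_comp_subst_apply Ψ.hasSubst Θ.hasSubst (Φ.toFun i)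
  one_mul Φ := by
    ext1
    funext i
    exact subst_X Φ.hasSubst i
  mul_one Φ := by
    ext1
    funext i
    exact congrFun subst_self (Φ.toFun i)

theorem mul_apply (Φ Ψ : FormalMap) (i : Fin 3) : (Φ * Ψ) i = subst Ψ.toFun (Φ i) := rfl

theorem one_apply (i : Fin 3) : (1 : FormalMap) i = X i := rfl

/-- The linear part `(∂φᵢ/∂xⱼ (0))ᵢⱼ` of `Φ` at the origin. -/
def linearPart (Φ : FormalMap) : Matrix (Fin 3) (Fin 3) ℂ :=
  Matrix.of fun i j => constantCoeff (pderiv ℂ j (Φ i))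

/-- The linear map with matrix `M`, as a formal map. -/
def ofMatrix (M : Matrix (Fin 3) (Fin 3) ℂ) : FormalMap :=
  ⟨fun i => ∑ j, M i j • X j, fun i => by simp [map_sum, smul_eq_C_mul]⟩

theorem ofMatrix_apply (M : Matrix (Fin 3) (Fin 3) ℂ) (i : Fin 3) :
    ofMatrix M i = ∑ j, M i j • X j := rfl

theorem linearPart_apply (Φ : FormalMap) (i j : Fin 3) :
    Φ.linearPart i j = coeff (Finsupp.single j 1) (Φ i) := by
  simp [linearPart, ← coeff_zero_eq_constantCoeff_apply, coeff_pderiv]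

theorem one_le_order (Φ : FormalMap) (i : Fin 3) : 1 ≤ (Φ i).order :=
  one_le_order_iff_constCoeff_eq_zero.2 (Φ.constantCoeff_eq_zero i)

/-- Composition with a linear map on the left. -/
theorem ofMatrix_mul_apply (M : Matrix (Fin 3) (Fin 3) ℂ) (Φ : FormalMap) (i : Fin 3) :
    (ofMatrix M * Φ) i = ∑ j, M i j • Φ j := by
  rw [mul_apply, ofMatrix_apply, ← coe_substAlgHom Φ.hasSubst, map_sum]
  refine Finset.sum_congr rfl fun j _ => ?_
  rw [map_smul, coe_substAlgHom, subst_X Φ.hasSubst]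

/-- Matrices as formal maps, multiplicatively. -/
def ofMatrixHom : Matrix (Fin 3) (Fin 3) ℂ →* FormalMap where
  toFun := ofMatrix
  map_one' := by
    ext1
    funext i
    change ∑ j, (1 : Matrix (Fin 3) (Fin 3) ℂ) i j • (X j : Series) = X i
    simp [Matrix.one_apply]
  map_mul' M N := by
    ext1
    funext i
    rw [ofMatrix_mul_apply]
    change ∑ j, (M * N) i j • (X j : Series) = _
    simp only [ofMatrix_apply, Matrix.mul_apply, Finset.sum_smul, Finset.smul_sum, mul_smul]
    exact Finset.sum_comm

/-- Substituting maps fixing the origin into a monomial of degree `|d|` gives order `≥ |d|`. -/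
theorem degree_le_order_prod (Φ : FormalMap) (d : Fin 3 →₀ ℕ) :
    (d.degree : ℕ∞) ≤ (d.prod fun s e => Φ s ^ e).order := by
  refine le_trans ?_ (le_order_prod _ _)
  rw [Finsupp.degree_apply, Nat.cast_sum]
  refine Finset.sum_le_sum fun s _ => ?_
  refine le_trans ?_ (le_order_pow _)
  rw [nsmul_eq_mul]
  exact le_mul_of_one_le_right zero_le (Φ.one_le_order s)

/-- Multi-indices of degree at most one. -/
theorem eq_zero_or_eq_single {d : Fin 3 →₀ ℕ} (hd : d.degree ≤ 1) :
    d = 0 ∨ ∃ k, d = Finsupp.single k 1 := by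
  by_cases hd0 : d = 0
  · exact Or.inl hd0
  · right
    obtain ⟨k, hk⟩ := Finsupp.ne_iff.1 hd0
    have hle : Finsupp.single k 1 ≤ d :=
      Finsupp.single_le_iff.2 (Nat.one_le_iff_ne_zero.2 hk)
    have hk' := tsub_add_cancel_of_le hle
    have hdeg : (d - Finsupp.single k 1).degree = 0 := by
      have := congrArg Finsupp.degree hk'
      rw [map_add, Finsupp.degree_single] at this
      omega
    rw [(Finsupp.degree_eq_zero_iff _).1 hdeg, zero_add] at hk'
    exact ⟨k, hk'.symm⟩

theorem linearPart_mul (Φ Ψ : FormalMap) :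
    (Φ * Ψ).linearPart = Φ.linearPart * Ψ.linearPart := by
  ext i j
  rw [Matrix.mul_apply, linearPart_apply, mul_apply, coeff_subst Ψ.hasSubst]
  have hinj : Function.Injective fun k : Fin 3 => (Finsupp.single k 1 : Fin 3 →₀ ℕ) :=
    Finsupp.single_left_injective one_ne_zero
  rw [finsum_eq_sum_of_support_subset (s := Finset.univ.image fun k => Finsupp.single k 1)]
  · rw [Finset.sum_image (fun a _ b _ h => hinj h)]
    refine Finset.sum_congr rfl fun k _ => ?_
    rw [linearPart_apply, linearPart_apply, Finsupp.prod_single_index (by simp)]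
    simp
  · intro d hd
    by_contra hne
    apply hd
    rcases Nat.lt_or_ge 1 d.degree with h2 | h1
    · have : coeff (Finsupp.single j 1) (d.prod fun s e => Ψ s ^ e) = 0 := by
        apply coeff_of_lt_order
        refine lt_of_lt_of_le ?_ (Ψ.degree_le_order_prod d)
        rw [Finsupp.degree_single]
        exact_mod_cast h2
      change coeff d (Φ i) • _ = (0 : ℂ)
      rw [this, smul_zero]
    · rcases eq_zero_or_eq_single h1 with rfl | ⟨k, rfl⟩
      · simp [coeff_one]
      · exact absurd (by simp) hne

theorem linearPart_one : (1 : FormalMap).linearPart = 1 := by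
  ext i j
  rw [linearPart_apply, one_apply, coeff_X, Matrix.one_apply]
  refine if_congr ?_ rfl rfl
  rw [(Finsupp.single_left_injective (one_ne_zero : (1 : ℕ) ≠ 0)).eq_iff, eq_comm]

/-- The linear part, multiplicatively. -/
def linearPartHom : FormalMap →* Matrix (Fin 3) (Fin 3) ℂ where
  toFun := linearPart
  map_one' := linearPart_one
  map_mul' := linearPart_mul

theorem linearPart_ofMatrix (M : Matrix (Fin 3) (Fin 3) ℂ) : (ofMatrix M).linearPart = M := by
  ext i j
  rw [linearPart_apply, ofMatrix_apply, map_sum]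
  simp only [coeff_smul, coeff_X, (Finsupp.single_left_injective
    (one_ne_zero : (1 : ℕ) ≠ 0)).eq_iff]
  simp

theorem le_order_prod_sub {Φ Ψ : FormalMap} {n : ℕ} (h : ∀ i, (n : ℕ∞) ≤ (Φ i - Ψ i).order)
    (d : Fin 3 →₀ ℕ) : (n : ℕ∞) + d.degree ≤
      ((d.prod fun s e => Φ s ^ e) - d.prod fun s e => Ψ s ^ e).order + 1 := by
  obtain ⟨m, hm⟩ : ∃ m, d.degree = m := ⟨_, rfl⟩
  induction m generalizing d with
  | zero =>
    have : d = 0 := (Finsupp.degree_eq_zero_iff d).1 hm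
    subst this
    simp
  | succ m ih =>
    have hd0 : d ≠ 0 := by
      rintro rfl
      simp at hm
    obtain ⟨k, hk⟩ := Finsupp.ne_iff.1 hd0
    have hle : Finsupp.single k 1 ≤ d :=
      Finsupp.single_le_iff.2 (Nat.one_le_iff_ne_zero.2 hk)
    obtain ⟨d', rfl⟩ : ∃ d', d = d' + Finsupp.single k 1 :=
      ⟨_, (tsub_add_cancel_of_le hle).symm⟩
    rw [map_add, Finsupp.degree_single] at hm
    have hd' : d'.degree = m := by omega
    have hprod : ∀ Θ : FormalMap, ((d' + Finsupp.single k 1).prod fun s e => Θ s ^ e) =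
        (d'.prod fun s e => Θ s ^ e) * Θ k := fun Θ => by
      rw [Finsupp.prod_add_index' (by simp) (fun a b c => pow_add _ b c),
        Finsupp.prod_single_index (by simp), pow_one]
    rw [hprod Φ, hprod Ψ]
    have heq : ∀ a b f g : Series, a * f - b * g = a * (f - g) + (a - b) * g := fun a b f g => by
      ring
    rw [heq, map_add, Finsupp.degree_single, hd']
    have h1 : (n : ℕ∞) + m ≤ ((d'.prod fun s e => Φ s ^ e) * (Φ k - Ψ k)).order := by
      refine le_trans ?_ le_order_mul
      rw [add_comm]
      refine add_le_add ?_ (h k)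
      rw [← hd']
      exact Φ.degree_le_order_prod d'
    have h2 : (n : ℕ∞) + m ≤
        (((d'.prod fun s e => Φ s ^ e) - d'.prod fun s e => Ψ s ^ e) * Ψ k).order := by
      refine le_trans ?_ le_order_mul
      rw [← hd']
      exact (ih d' hd').trans (by gcongr; exact Ψ.one_le_order k)
    push_cast
    rw [← add_assoc]
    gcongr
    exact (le_min h1 h2).trans min_order_le_add

/-- If `f` has no terms of degree `≤ 1`, then substitution into `f` is contracting. -/
theorem le_order_subst_sub {Φ Ψ : FormalMap} {n : ℕ} (h : ∀ i, (n : ℕ∞) ≤ (Φ i - Ψ i).order)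
    {f : Series} (hf : ∀ d, d.degree ≤ 1 → coeff d f = 0) :
    ((n + 1 : ℕ) : ℕ∞) ≤ (subst Φ.toFun f - subst Ψ.toFun f).order := by
  refine nat_le_order fun e he => ?_
  rw [map_sub, coeff_subst Φ.hasSubst, coeff_subst Ψ.hasSubst, sub_eq_zero]
  refine finsum_congr fun d => ?_
  rcases Nat.lt_or_ge 1 d.degree with hd | hd
  · congr 1
    rw [← sub_eq_zero, ← map_sub]
    apply coeff_of_lt_order
    have h1 := le_order_prod_sub h d
    have h2 : ((n + 1 : ℕ) : ℕ∞) + 1 ≤ (n : ℕ∞) + d.degree := by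
      norm_cast
      omega
    have h3 := (ENat.add_le_add_iff_right (by simp)).1 (h2.trans h1)
    exact lt_of_lt_of_le (by exact_mod_cast he) h3
  · rw [hf d hd, zero_smul, zero_smul]

/-- The iteration `Ψ ↦ id - (Φ - id) ∘ Ψ` used to invert `Φ`. -/
def invIter (Φ : FormalMap) : ℕ → FormalMap
  | 0 => 1
  | n + 1 => ⟨fun i => X i - subst (invIter Φ n).toFun (Φ i - X i), fun i => by
      rw [map_sub, constantCoeff_X, constantCoeff_subst_eq_zero (invIter Φ n).hasSubst
        (invIter Φ n).constantCoeff_eq_zero (by simp [Φ.constantCoeff_eq_zero]), sub_zero]⟩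

theorem invIter_succ_apply (Φ : FormalMap) (n : ℕ) (i : Fin 3) :
    invIter Φ (n + 1) i = X i - subst (invIter Φ n).toFun (Φ i - X i) := rfl

theorem coeff_sub_X_eq_zero {Φ : FormalMap} (hΦ : Φ.linearPart = 1) (i : Fin 3)
    (d : Fin 3 →₀ ℕ) (hd : d.degree ≤ 1) : coeff d (Φ i - X i) = 0 := by
  rcases eq_zero_or_eq_single hd with rfl | ⟨k, rfl⟩
  · simp [Φ.constantCoeff_eq_zero]
  · rw [map_sub, ← linearPart_apply, hΦ, ← linearPart_one, linearPart_apply, one_apply, sub_self]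

theorem le_order_invIter_succ_sub {Φ : FormalMap} (hΦ : Φ.linearPart = 1) (n : ℕ) (i : Fin 3) :
    ((n + 1 : ℕ) : ℕ∞) ≤ (invIter Φ (n + 1) i - invIter Φ n i).order := by
  induction n generalizing i with
  | zero =>
    rw [zero_add, Nat.cast_one, one_le_order_iff_constCoeff_eq_zero, map_sub,
      constantCoeff_eq_zero, constantCoeff_eq_zero, sub_zero]
  | succ n ih =>
    rw [invIter_succ_apply, invIter_succ_apply, sub_sub_sub_cancel_left, ← order_neg, neg_sub]
    exact le_order_subst_sub ih (coeff_sub_X_eq_zero hΦ i)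

theorem coeff_invIter {Φ : FormalMap} (hΦ : Φ.linearPart = 1) (i : Fin 3) (e : Fin 3 →₀ ℕ)
    {n : ℕ} (hn : e.degree ≤ n) :
    coeff e (invIter Φ n i) = coeff e (invIter Φ e.degree i) := by
  induction n, hn using Nat.le_induction with
  | base => rfl
  | succ n hn ih =>
    rw [← ih, ← sub_eq_zero, ← map_sub]
    apply coeff_of_lt_order
    refine lt_of_lt_of_le ?_ (le_order_invIter_succ_sub hΦ n i)
    exact_mod_cast Nat.lt_succ_of_le hn

theorem exists_mul_eq_one {Φ : FormalMap} (hΦ : Φ.linearPart = 1) :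
    ∃ Ψ : FormalMap, Φ * Ψ = 1 := by
  let ψ : Fin 3 → Series := fun i e => coeff e (invIter Φ e.degree i)
  have hψ : ∀ i e, coeff e (ψ i) = coeff e (invIter Φ e.degree i) := fun i e => rfl
  let Ψ : FormalMap := ⟨ψ, fun i => by
    rw [← coeff_zero_eq_constantCoeff_apply, hψ, coeff_zero_eq_constantCoeff_apply,
      constantCoeff_eq_zero]⟩
  have hΨ : ∀ i e, coeff e (Ψ i) = coeff e (invIter Φ e.degree i) := hψ
  have hord : ∀ n i, ((n + 1 : ℕ) : ℕ∞) ≤ (Ψ i - invIter Φ n i).order := fun n i => by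
    refine nat_le_order fun e he => ?_
    rw [map_sub, hΨ, coeff_invIter hΦ i e (by omega : e.degree ≤ n), sub_self]
  refine ⟨Ψ, ?_⟩
  ext i e
  have hsub : (Φ * Ψ) i = Ψ i + subst Ψ.toFun (Φ i - X i) := by
    rw [mul_apply, ← coe_substAlgHom Ψ.hasSubst, map_sub, coe_substAlgHom,
      subst_X Ψ.hasSubst]
    ring
  have h1 := le_order_subst_sub (hord e.degree) (coeff_sub_X_eq_zero hΦ i)
  have h2 : coeff e (subst Ψ.toFun (Φ i - X i)) =
      coeff e (subst (invIter Φ e.degree).toFun (Φ i - X i)) := by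
    rw [← sub_eq_zero, ← map_sub]
    apply coeff_of_lt_order
    refine lt_of_lt_of_le ?_ h1
    norm_cast
    omega
  have h3 : coeff e (Ψ i) = coeff e (invIter Φ (e.degree + 1) i) := by
    rw [hΨ, coeff_invIter hΦ i e (Nat.le_succ _)]
  rw [invIter_succ_apply, map_sub] at h3
  change coeff e ((Φ * Ψ) i) = coeff e (X i)
  rw [hsub, map_add, h2, h3, sub_add_cancel]

/-- Formal inverse function theorem: a formal map fixing the origin is invertible for the
composition if and only if its Jacobian matrix at the origin is invertible. -/
theorem isUnit_iff (Φ : FormalMap) : IsUnit Φ ↔ IsUnit Φ.linearPart := by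
  have key : ∀ Ψ : FormalMap, Ψ.linearPart = 1 → IsUnit Ψ := fun Ψ hΨ => by
    obtain ⟨Θ, hΘ⟩ := exists_mul_eq_one hΨ
    have hΘ1 : Θ.linearPart = 1 := by
      have := congrArg linearPart hΘ
      rwa [linearPart_mul, hΨ, one_mul, linearPart_one] at this
    obtain ⟨Ξ, hΞ⟩ := exists_mul_eq_one hΘ1
    have : Ψ = Ξ := by rw [← mul_one Ψ, ← hΞ, ← mul_assoc, hΘ, one_mul]
    subst this
    exact ⟨⟨Ψ, Θ, hΘ, hΞ⟩, rfl⟩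
  refine ⟨fun h => h.map linearPartHom, ?_⟩
  rintro ⟨L, hL⟩
  have h1 : IsUnit (ofMatrixHom (L⁻¹ : (Matrix (Fin 3) (Fin 3) ℂ)ˣ) * Φ) := by
    apply key
    rw [linearPart_mul, ← hL]
    change (ofMatrix _).linearPart * _ = 1
    rw [linearPart_ofMatrix, Units.inv_mul]
  have h2 : IsUnit (ofMatrixHom (L : Matrix (Fin 3) (Fin 3) ℂ)) := L.isUnit.map _
  have h3 := h2.mul h1
  rwa [← mul_assoc, ← map_mul, Units.mul_inv, map_one, one_mul] at h3

end FormalMap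

/-- The group of formal diffeomorphisms of `(ℂ³, 0)`: the formal maps fixing the origin that
are invertible for the composition. By `FormalMap.isUnit_iff` these are exactly the formal maps
fixing the origin whose Jacobian matrix at the origin is invertible. -/
abbrev FormalDiffeo : Type := FormalMapˣ

/-- The subgroup of the diffeomorphisms fibered in `x`, that is, of the form
`(x, y) ↦ (x, φ(x, y))`. -/
def fiberedDiffeo : Subgroup FormalDiffeo where
  carrier := {Φ | (Φ : FormalMap) 0 = X 0}
  one_mem' := rfl
  mul_mem' {Φ Ψ} hΦ hΨ := by
    change subst _ ((Φ : FormalMap) 0) = X 0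
    rw [show (Φ : FormalMap) 0 = X 0 from hΦ, subst_X (Ψ : FormalMap).hasSubst]
    exact hΨ
  inv_mem' {Φ} hΦ := by
    have h : ((Φ : FormalMap) * (Φ⁻¹ : FormalDiffeo)) 0 = X 0 := by
      rw [Units.mul_inv]
      rfl
    rw [FormalMap.mul_apply, show (Φ : FormalMap) 0 = X 0 from hΦ,
      subst_X (FormalMap.hasSubst _)] at h
    exact h

/-- The push-forward `Φ_*(Y) = (DΦ · Y) ∘ Φ⁻¹`. -/
def pushforward (Φ : FormalDiffeo) (Y : VectorField) : VectorField := fun i =>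
  subst ((Φ⁻¹ : FormalDiffeo) : FormalMap).toFun (∑ j, pderiv ℂ j ((Φ : FormalMap) i) * Y j)

/-- The formal fibered isotropies of `Y`: the fibered diffeomorphisms with `Φ_*(Y) = Y`. -/
def fiberedIsotropy (Y : VectorField) : Set FormalDiffeo :=
  {Φ | Φ ∈ fiberedDiffeo ∧ pushforward Φ Y = Y}

/-- The parameter space of the normal forms of non-degenerate doubly-resonant saddle-nodes:
`(λ, a₁, a₂, c₁, c₂)` with `λ ≠ 0`, `a₁ + a₂ ∉ ℚ_{≤ 0}` and `c₁, c₂ ∈ v ℂ⟦v⟧`. -/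
structure Parameters where
  lam : ℂ
  a₁ : ℂ
  a₂ : ℂ
  c₁ : PowerSeries ℂ
  c₂ : PowerSeries ℂ
  lam_ne_zero : lam ≠ 0
  nondegenerate : ∀ q : ℚ, q ≤ 0 → a₁ + a₂ ≠ (q : ℂ)
  constantCoeff_c₁ : PowerSeries.constantCoeff c₁ = 0
  constantCoeff_c₂ : PowerSeries.constantCoeff c₂ = 0

/-- The normal form
`x² ∂/∂x + (-λ + a₁ x + c₁(y₁ y₂)) y₁ ∂/∂y₁ + (λ + a₂ x + c₂(y₁ y₂)) y₂ ∂/∂y₂`. -/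
def normalForm (p : Parameters) : VectorField :=
  ![X 0 ^ 2,
    (-C p.lam + C p.a₁ * X 0 + PowerSeries.subst (X 1 * X 2 : Series) p.c₁) * X 1,
    (C p.lam + C p.a₂ * X 0 + PowerSeries.subst (X 1 * X 2 : Series) p.c₂) * X 2]

/-- The linear diffeomorphism `diag(1, θ₁, θ₂) : (x, y₁, y₂) ↦ (x, θ₁ y₁, θ₂ y₂)`. -/
def diag (θ₁ θ₂ : ℂˣ) : FormalDiffeo :=
  Units.map FormalMap.ofMatrixHom
    ⟨Matrix.diagonal ![1, (θ₁ : ℂ), (θ₂ : ℂ)],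
      Matrix.diagonal ![1, ((θ₁⁻¹ : ℂˣ) : ℂ), ((θ₂⁻¹ : ℂˣ) : ℂ)],
      by
        rw [Matrix.diagonal_mul_diagonal, ← Matrix.diagonal_one]
        congr 1
        funext i
        fin_cases i <;> simp,
      by
        rw [Matrix.diagonal_mul_diagonal, ← Matrix.diagonal_one]
        congr 1
        funext i
        fin_cases i <;> simp⟩

theorem diag_apply (θ₁ θ₂ : ℂˣ) (i : Fin 3) :
    (diag θ₁ θ₂ : FormalMap) i =
      ![(X 0 : Series), C (θ₁ : ℂ) * X 1, C (θ₂ : ℂ) * X 2] i := by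
  change FormalMap.ofMatrix _ i = _
  rw [FormalMap.ofMatrix_apply]
  fin_cases i <;> simp [Matrix.diagonal_apply, smul_eq_C_mul]

end DoublyResonant

end

noncomputable section

namespace DoublyResonant

open MvPowerSeries

/-! Composing with `Φ` removes the inverse from `Φ_*(Z) = Z` and leaves Z(Φᵢ) = Zᵢ ∘ Φ. Write Zᵢ =
zᵢ (μᵢ + ρᵢ x + cᵢ(v)) with z = (x, y₁, y₂), v = y₁y₂, μ = (0, -λ, λ), ρ = (1, a₁, a₂). The equation
is solved degree by degree in y.

In degree 0, the restriction of Φᵢ to y = 0 vanishes because μᵢ ≠ 0 for i = 1, 2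
(`mem_yFiltration_one`). Let mᵢ be the coefficient of yᵢ in Φᵢ, put θ = m₁m₂ and Rᵢ = Φᵢ - mᵢyᵢ. If
R₁ and R₂ have no terms of y-degree below j, then modulo y-degree j + 1 (D_μ - μᵢ)Rᵢ + x(D_ρ - ρᵢ)Rᵢ
≡ mᵢyᵢ(cᵢ(θv) - cᵢ(v)), where D_t = ∑ tₖ zₖ ∂/∂zₖ (`homological_equation`). The right side contains
only resonant monomials free of x. Nonresonant coefficients of Rᵢ vanish by induction on the power
of x. For a resonant monomial x^k vⁿ yᵢ, the coefficient of the equation one power of x higher does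
not see the right side, and gives k + n(a₁ + a₂) times the unknown; by nondegeneracy this factor
vanishes only for yᵢ itself, which Rᵢ lacks by construction (`remainder_mem_succ`). Hence Rᵢ = 0 and
`Φ` is diagonal; for a diagonal map the equation reduces to cᵢ(θv) = cᵢ(v) (`equation_diag_iff`). -/

/-! ### Filtration by degree in (y₁, y₂) -/

/-- The series all of whose monomials have degree at least `j` in `(y₁, y₂)`. -/
def yFiltration (j : ℕ) : Ideal Series where
  carrier := {f | ∀ e : Fin 3 →₀ ℕ, e 1 + e 2 < j → coeff e f = 0}
  zero_mem' _ _ := map_zero _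
  add_mem' hf hg e he := by rw [map_add, hf e he, hg e he, add_zero]
  smul_mem' a f hf e he := by
    rw [smul_eq_mul, coeff_mul]
    refine Finset.sum_eq_zero fun q hq => ?_
    rw [Finset.HasAntidiagonal.mem_antidiagonal] at hq
    rw [hf q.2 (by rw [← hq] at he; simp only [Finsupp.add_apply] at he; omega), mul_zero]

theorem yFiltration_zero (f : Series) : f ∈ yFiltration 0 :=
  fun _ he => absurd he (Nat.not_lt_zero _)

theorem yFiltration_anti {j k : ℕ} (h : j ≤ k) {f : Series} (hf : f ∈ yFiltration k) :
    f ∈ yFiltration j := fun e he => hf e (he.trans_le h)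

theorem mul_mem_yFiltration {j k : ℕ} {f g : Series} (hf : f ∈ yFiltration j)
    (hg : g ∈ yFiltration k) : f * g ∈ yFiltration (j + k) := fun e he => by
  rw [coeff_mul]
  refine Finset.sum_eq_zero fun q hq => ?_
  rw [Finset.HasAntidiagonal.mem_antidiagonal] at hq
  rw [← hq] at he
  simp only [Finsupp.add_apply] at he
  rcases lt_or_ge (q.1 1 + q.1 2) j with h | h
  · rw [hf q.1 h, zero_mul]
  · rw [hg q.2 (by omega), mul_zero]

theorem X_mem_yFiltration {i : Fin 3} (hi : i ≠ 0) : (X i : Series) ∈ yFiltration 1 :=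
  fun e he => by
    rw [coeff_X, if_neg]
    rintro rfl
    fin_cases i <;> simp at he hi

theorem eq_zero_of_forall_mem_yFiltration {f : Series} (hf : ∀ j, f ∈ yFiltration j) : f = 0 := by
  ext e
  exact hf _ e (Nat.lt_succ_self _)

/-- A - B divides Aⁿ - Bⁿ for every n, and the filtration steps are ideals. -/
theorem subst_sub_subst_mem_yFiltration {A B : Series} (hA : constantCoeff A = 0)
    (hB : constantCoeff B = 0) (c : PowerSeries ℂ) {j : ℕ} (h : A - B ∈ yFiltration j) :
    PowerSeries.subst A c - PowerSeries.subst B c ∈ yFiltration j := fun e he => by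
  rw [map_sub, PowerSeries.coeff_subst (.of_constantCoeff_zero hA),
    PowerSeries.coeff_subst (.of_constantCoeff_zero hB), sub_eq_zero]
  refine finsum_congr fun n => ?_
  congr 1
  rw [← sub_eq_zero, ← map_sub]
  exact Ideal.mem_of_dvd _ (sub_dvd_pow_sub_pow A B n) h e he

theorem subst_mem_yFiltration {A : Series} (hA : constantCoeff A = 0) {c : PowerSeries ℂ}
    (hc : PowerSeries.constantCoeff c = 0) {j : ℕ} (h : A ∈ yFiltration j) :
    PowerSeries.subst A c ∈ yFiltration j := by
  have := subst_sub_subst_mem_yFiltration hA (map_zero _) c (j := j) (B := 0) (by rwa [sub_zero])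
  rwa [PowerSeries.subst_zero_of_constantCoeff_zero hc, sub_zero] at this

/-! ### Series in the resonant monomial y₁y₂ -/

/-- The exponent of `(y₁ y₂) ^ n`. -/
def resonantExponent (n : ℕ) : Fin 3 →₀ ℕ := Finsupp.single 1 n + Finsupp.single 2 n

theorem pow_eq_monomial (t : ℂ) (n : ℕ) :
    (C t * (X 1 * X 2) : Series) ^ n = monomial (resonantExponent n) (t ^ n) := by
  rw [mul_pow, mul_pow, X_pow_eq, X_pow_eq, monomial_mul_monomial, ← map_pow, ← smul_eq_C_mul,
    ← map_smul]
  simp [resonantExponent]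

theorem constantCoeff_C_mul_X_mul_X (t : ℂ) :
    constantCoeff (C t * (X 1 * X 2) : Series) = 0 := by simp

theorem coeff_subst_resonant (t : ℂ) (c : PowerSeries ℂ) (n : ℕ) :
    coeff (resonantExponent n) (PowerSeries.subst (C t * (X 1 * X 2) : Series) c) =
      PowerSeries.coeff n c * t ^ n := by
  rw [PowerSeries.coeff_subst (.of_constantCoeff_zero (constantCoeff_C_mul_X_mul_X t)),
    finsum_eq_single _ n]
  · rw [pow_eq_monomial, coeff_monomial_same, smul_eq_mul]
  · intro m hm
    rw [pow_eq_monomial, coeff_monomial_ne, smul_zero]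
    intro h
    apply hm
    simpa [resonantExponent] using (DFunLike.congr_fun h 1).symm

theorem coeff_subst_eq_zero (t : ℂ) (c : PowerSeries ℂ) {e : Fin 3 →₀ ℕ}
    (he : ¬ (e 0 = 0 ∧ e 1 = e 2)) :
    coeff e (PowerSeries.subst (C t * (X 1 * X 2) : Series) c) = 0 := by
  rw [PowerSeries.coeff_subst (.of_constantCoeff_zero (constantCoeff_C_mul_X_mul_X t))]
  refine finsum_eq_zero_of_forall_eq_zero fun n => ?_
  rw [pow_eq_monomial, coeff_monomial_ne, smul_zero]
  rintro rfl
  exact he (by simp [resonantExponent])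

/-! ### Diagonal operators on coefficients -/

theorem coeff_X_mul_of_eq_zero {i : Fin 3} {e : Fin 3 →₀ ℕ} (he : e i = 0) (f : Series) :
    coeff e (X i * f) = 0 := by
  rw [X, coeff_monomial_mul, if_neg]
  rw [Finsupp.single_le_iff, he]
  simp

theorem coeff_X_mul_add (i : Fin 3) (e : Fin 3 →₀ ℕ) (f : Series) :
    coeff (e + Finsupp.single i 1) (X i * f) = coeff e f := by
  rw [X, add_comm, coeff_add_monomial_mul, one_mul]

theorem exists_eq_add_single {i : Fin 3} {e : Fin 3 →₀ ℕ} (he : e i ≠ 0) :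
    ∃ e', e = e' + Finsupp.single i 1 :=
  ⟨_, (tsub_add_cancel_of_le (Finsupp.single_le_iff.2 (Nat.one_le_iff_ne_zero.2 he))).symm⟩

theorem coeff_X_mul_pderiv (i : Fin 3) (f : Series) (e : Fin 3 →₀ ℕ) :
    coeff e (X i * pderiv ℂ i f) = e i * coeff e f := by
  by_cases he : e i = 0
  · rw [coeff_X_mul_of_eq_zero he, he, Nat.cast_zero, zero_mul]
  · obtain ⟨e', rfl⟩ := exists_eq_add_single he
    rw [coeff_X_mul_add, coeff_pderiv]
    simp [mul_comm]

/-- The operator `∑ tⱼ zⱼ ∂/∂zⱼ` in the coordinates `z = (x, y₁, y₂)`. -/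
def diagonalDerivation (t : Fin 3 → ℂ) (f : Series) : Series :=
  ∑ j, C (t j) * (X j * pderiv ℂ j f)

theorem coeff_diagonalDerivation (t : Fin 3 → ℂ) (f : Series) (e : Fin 3 →₀ ℕ) :
    coeff e (diagonalDerivation t f) = (∑ j, t j * e j) * coeff e f := by
  rw [diagonalDerivation, map_sum, Finset.sum_mul]
  refine Finset.sum_congr rfl fun j _ => ?_
  rw [coeff_C_mul, coeff_X_mul_pderiv, mul_assoc]

theorem X_mul_pderiv_mem_yFiltration (i : Fin 3) {f : Series} {j : ℕ} (hf : f ∈ yFiltration j) :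
    X i * pderiv ℂ i f ∈ yFiltration j := fun e he => by
  rw [coeff_X_mul_pderiv, hf e he, mul_zero]

/-! ### Logarithmic form of the vector field and the symmetry equation -/

namespace Parameters

/-- The eigenvalues of the linear part of the normal form. -/
def eigenvalue (p : Parameters) : Fin 3 → ℂ := ![0, -p.lam, p.lam]

/-- The coefficients of `x` in the logarithmic components of the normal form. -/
def residue (p : Parameters) : Fin 3 → ℂ := ![1, p.a₁, p.a₂]

/-- The nonlinear parts of the logarithmic components of the normal form. -/
def nonlinear (p : Parameters) : Fin 3 → PowerSeries ℂ := ![0, p.c₁, p.c₂]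

theorem constantCoeff_nonlinear (p : Parameters) (i : Fin 3) :
    PowerSeries.constantCoeff (p.nonlinear i) = 0 := by
  fin_cases i
  · exact map_zero _
  · exact p.constantCoeff_c₁
  · exact p.constantCoeff_c₂

/-- The component of index `i` of the normal form, divided by the coordinate of index `i`, with
`f` and `w` in the place of `x` and `y₁ y₂`. -/
def logComponent (p : Parameters) (i : Fin 3) (f w : Series) : Series :=
  C (p.eigenvalue i) + C (p.residue i) * f + PowerSeries.subst w (p.nonlinear i)

/-- The x-component fits the same pattern, since x² = (0 + 1·x + 0)·x; all three indices can then be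
treated uniformly. -/
theorem normalForm_apply (p : Parameters) (i : Fin 3) :
    normalForm p i = p.logComponent i (X 0) (X 1 * X 2) * X i := by
  fin_cases i
  · have : PowerSeries.subst (X 1 * X 2 : Series) (0 : PowerSeries ℂ) = 0 := by
      rw [← PowerSeries.coe_substAlgHom (.of_constantCoeff_zero (by simp)), map_zero]
    simp [normalForm, logComponent, eigenvalue, residue, nonlinear, this, sq]
  · simp [normalForm, logComponent, eigenvalue, residue, nonlinear]
  · simp [normalForm, logComponent, eigenvalue, residue, nonlinear]

theorem subst_normalForm (p : Parameters) (Φ : FormalMap) (i : Fin 3) :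
    subst Φ.toFun (normalForm p i) = p.logComponent i (Φ 0) (Φ 1 * Φ 2) * Φ i := by
  have hsub : subst Φ.toFun (PowerSeries.subst (X 1 * X 2 : Series) (p.nonlinear i)) =
      PowerSeries.subst (Φ 1 * Φ 2) (p.nonlinear i) := by
    rw [PowerSeries.subst_def, PowerSeries.subst_def, subst_comp_subst_apply
      (PowerSeries.HasSubst.const (.of_constantCoeff_zero (by simp))) Φ.hasSubst]
    congr 1
    funext _
    rw [subst_mul Φ.hasSubst, subst_X Φ.hasSubst, subst_X Φ.hasSubst]
  have hC : ∀ a : ℂ, subst Φ.toFun (C a : Series) = C a := fun a => by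
    rw [← mul_one (C a), ← smul_eq_C_mul, ← coe_substAlgHom Φ.hasSubst, map_smul, map_one]
  rw [normalForm_apply, logComponent, subst_mul Φ.hasSubst, subst_add Φ.hasSubst,
    subst_add Φ.hasSubst, subst_mul Φ.hasSubst, subst_X Φ.hasSubst, subst_X Φ.hasSubst, hsub,
    hC, hC, logComponent]

end Parameters

/-- Substituting `Φ` on both sides cancels its inverse, so that only an equation on the components
of `Φ` remains. -/
theorem pushforward_eq_iff (Φ : FormalDiffeo) (Y : VectorField) :
    pushforward Φ Y = Y ↔ ∀ i, ∑ j, pderiv ℂ j ((Φ : FormalMap) i) * Y j =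
      subst (Φ : FormalMap).toFun (Y i) := by
  have hcomp : ∀ (Ψ : FormalDiffeo) (f : Series),
      subst (Ψ : FormalMap).toFun (subst ((Ψ⁻¹ : FormalDiffeo) : FormalMap).toFun f) = f := by
    intro Ψ f
    rw [subst_comp_subst_apply (FormalMap.hasSubst _) (FormalMap.hasSubst _)]
    change subst ((Ψ⁻¹ : FormalDiffeo) * (Ψ : FormalMap) : FormalMap).toFun f = f
    rw [Units.inv_mul]
    exact congrFun subst_self f
  constructor
  · intro h i
    rw [← congrFun h i]
    exact (hcomp _ _).symm
  · intro h
    funext i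
    rw [pushforward, h i]
    simpa using hcomp Φ⁻¹ (Y i)

/-- Splits the derivation Z by its effect on monomials: a diagonal part, x times a diagonal part,
and a part that raises the degree in y. -/
theorem sum_pderiv_mul_normalForm (p : Parameters) (f : Series) :
    ∑ j, pderiv ℂ j f * normalForm p j =
      diagonalDerivation p.eigenvalue f + X 0 * diagonalDerivation p.residue f +
        ∑ j, PowerSeries.subst (X 1 * X 2 : Series) (p.nonlinear j) * (X j * pderiv ℂ j f) := by
  rw [diagonalDerivation, diagonalDerivation, Finset.mul_sum, ← Finset.sum_add_distrib,
    ← Finset.sum_add_distrib]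
  refine Finset.sum_congr rfl fun j _ => ?_
  rw [p.normalForm_apply, Parameters.logComponent]
  ring

theorem pderiv_C_mul (i : Fin 3) (a : ℂ) (f : Series) :
    pderiv ℂ i (C a * f) = C a * pderiv ℂ i f := by
  ext e
  rw [coeff_pderiv, coeff_C_mul, coeff_C_mul, coeff_pderiv, mul_assoc]

theorem diagonalDerivation_X (t : Fin 3 → ℂ) (i : Fin 3) :
    diagonalDerivation t (X i) = C (t i) * X i := by
  rw [diagonalDerivation, Finset.sum_eq_single i, pderiv_X_self, mul_one]
  · intro j _ hj
    rw [pderiv_X_of_ne hj.symm, mul_zero, mul_zero]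
  · simp

theorem diagonalDerivation_add_C_mul (t : Fin 3 → ℂ) (a : ℂ) (f g : Series) :
    diagonalDerivation t (f + C a * g) =
      diagonalDerivation t f + C a * diagonalDerivation t g := by
  ext e
  simp only [coeff_diagonalDerivation, map_add, coeff_C_mul]
  ring

/-- The fibered formal maps that satisfy the equations of a symmetry of the normal form. -/
structure IsSymmetry (p : Parameters) (Φ : FormalMap) : Prop where
  fibered : Φ 0 = X 0
  equation : ∀ i, ∑ j, pderiv ℂ j (Φ i) * normalForm p j =
    p.logComponent i (X 0) (Φ 1 * Φ 2) * Φ i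

theorem mem_fiberedIsotropy_iff (p : Parameters) (Φ : FormalDiffeo) :
    Φ ∈ fiberedIsotropy (normalForm p) ↔ IsSymmetry p (Φ : FormalMap) := by
  have key : (Φ : FormalMap) 0 = X 0 → (pushforward Φ (normalForm p) = normalForm p ↔
      ∀ i, ∑ j, pderiv ℂ j ((Φ : FormalMap) i) * normalForm p j =
        p.logComponent i (X 0) ((Φ : FormalMap) 1 * (Φ : FormalMap) 2) * (Φ : FormalMap) i) := by
    intro h0
    rw [pushforward_eq_iff]
    refine forall_congr' fun i => ?_
    rw [p.subst_normalForm, h0]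
  exact ⟨fun h => ⟨h.1, (key h.1).1 h.2⟩, fun h => ⟨h.1, (key h.1).2 h.2⟩⟩

/-! ### Invariance of the x-axis -/

namespace IsSymmetry

variable {p : Parameters} {Φ : FormalMap}

theorem constantCoeff_mul (Φ : FormalMap) : constantCoeff (Φ 1 * Φ 2) = 0 := by
  rw [map_mul, Φ.constantCoeff_eq_zero, zero_mul]

/-- Each zₖ∂/∂zₖ keeps the y-degree and each cₖ(y₁y₂) has no constant term. The gain is really 2,
but 1 suffices. -/
theorem sum_subst_mul_mem_yFiltration (p : Parameters) {f : Series} {j : ℕ}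
    (hf : f ∈ yFiltration j) :
    ∑ k, PowerSeries.subst (X 1 * X 2 : Series) (p.nonlinear k) * (X k * pderiv ℂ k f) ∈
      yFiltration (j + 1) := by
  refine Ideal.sum_mem _ fun k _ => ?_
  rw [add_comm]
  refine mul_mem_yFiltration ?_ (X_mul_pderiv_mem_yFiltration k hf)
  exact subst_mem_yFiltration (by simp) (p.constantCoeff_nonlinear k)
    (Ideal.mul_mem_left _ _ (X_mem_yFiltration (by decide)))

theorem eigenvalue_ne_zero (p : Parameters) {i : Fin 3} (hi : i ≠ 0) : p.eigenvalue i ≠ 0 := by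
  fin_cases i
  · exact absurd rfl hi
  · exact neg_ne_zero.2 p.lam_ne_zero
  · exact p.lam_ne_zero

/-- A symmetry preserves the `x`-axis. -/
theorem mem_yFiltration_one (h : IsSymmetry p Φ) {i : Fin 3} (hi : i ≠ 0) :
    Φ i ∈ yFiltration 1 := by
  suffices H : ∀ n : ℕ, ∀ e : Fin 3 →₀ ℕ, e 0 = n → e 1 + e 2 < 1 → coeff e (Φ i) = 0 from
    fun e he => H _ e rfl he
  intro n
  -- The induction is on the power of x. It is strong because the product with cᵢ(Φ₁Φ₂) involves all
  -- lower powers.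
  induction n using Nat.strong_induction_on with
  | _ n ih =>
    intro e hn he
    have he1 : e 1 = 0 := by omega
    have he2 : e 2 = 0 := by omega
    have hX : ∀ f : Series, (∀ e', e = e' + Finsupp.single 0 1 → coeff e' f = 0) →
        coeff e (X 0 * f) = 0 := by
      intro f hf
      by_cases h0 : e 0 = 0
      · exact coeff_X_mul_of_eq_zero h0 f
      · obtain ⟨e', rfl⟩ := exists_eq_add_single h0
        rw [coeff_X_mul_add]
        exact hf e' rfl
    have hprev : ∀ e', e = e' + Finsupp.single 0 1 → coeff e' (Φ i) = 0 := by
      rintro e' rfl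
      simp at hn he
      exact ih (e' 0) (by omega) e' rfl (by omega)
    have hB : coeff e (X 0 * diagonalDerivation p.residue (Φ i)) = 0 := hX _ fun e' he' => by
      rw [coeff_diagonalDerivation, hprev e' he', mul_zero]
    have hA : coeff e (diagonalDerivation p.eigenvalue (Φ i)) = 0 := by
      rw [coeff_diagonalDerivation]
      simp [Fin.sum_univ_three, Parameters.eigenvalue, he1, he2]
    have hN : coeff e (∑ k, PowerSeries.subst (X 1 * X 2 : Series) (p.nonlinear k) *
        (X k * pderiv ℂ k (Φ i))) = 0 :=
      sum_subst_mul_mem_yFiltration p (yFiltration_zero (Φ i)) e (by omega)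
    -- Φ₁Φ₂ is only known to vanish at the origin here. This is enough: cᵢ(Φ₁Φ₂) has no constant
    -- term, so the other factor always contributes a strictly lower power of x.
    have hR : coeff e (PowerSeries.subst (Φ 1 * Φ 2) (p.nonlinear i) * Φ i) = 0 := by
      rw [coeff_mul]
      refine Finset.sum_eq_zero fun q hq => ?_
      rw [Finset.HasAntidiagonal.mem_antidiagonal] at hq
      subst hq
      simp only [Finsupp.add_apply] at hn he
      by_cases h0 : q.1 0 = 0
      · have : q.1 = 0 := by
          ext k
          fin_cases k
          · exact h0
          · exact (by omega : q.1 1 = 0)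
          · exact (by omega : q.1 2 = 0)
        rw [this, coeff_zero_eq_constantCoeff_apply, PowerSeries.constantCoeff_subst_eq_zero
          (constantCoeff_mul Φ) _ (p.constantCoeff_nonlinear i), zero_mul]
      · rw [ih (q.2 0) (by omega) q.2 rfl (by omega), mul_zero]
    -- All that survives is 0 = μᵢ · `coeff e (Φ i)`.
    have heq := congrArg (coeff e) (h.equation i)
    rw [sum_pderiv_mul_normalForm, map_add, map_add, hA, hB, hN, Parameters.logComponent, add_mul,
      add_mul, map_add, map_add, hR, coeff_C_mul, mul_assoc, coeff_C_mul, hX _ hprev, mul_zero,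
      add_zero, add_zero, add_zero, add_zero] at heq
    exact (mul_eq_zero.1 heq.symm).resolve_left (eigenvalue_ne_zero p hi)

/-! ### Resonances and nondegeneracy -/

/-- The resonant monomials in the component of index `i` are the `x ^ k (y₁ y₂) ^ n yᵢ`. -/
theorem sum_eigenvalue_eq_iff (p : Parameters) {i : Fin 3} (hi : i ≠ 0) (e : Fin 3 →₀ ℕ) :
    ∑ k, p.eigenvalue k * e k = p.eigenvalue i ↔
      ∃ n, e 1 = (resonantExponent n + Finsupp.single i 1 : Fin 3 →₀ ℕ) 1 ∧
        e 2 = (resonantExponent n + Finsupp.single i 1 : Fin 3 →₀ ℕ) 2 := by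
  have hl := p.lam_ne_zero
  fin_cases i
  · exact absurd rfl hi
  · simp only [Fin.sum_univ_three, Parameters.eigenvalue, resonantExponent]
    simp
    constructor
    · intro h
      have : p.lam * ((e 2 : ℂ) + 1 - e 1) = 0 := by linear_combination h
      have h2 := (mul_eq_zero.1 this).resolve_left hl
      have h3 : (e 2 + 1 : ℂ) = e 1 := by linear_combination h2
      exact_mod_cast h3.symm
    · intro h
      rw [h]
      push_cast
      ring
  · simp only [Fin.sum_univ_three, Parameters.eigenvalue, resonantExponent]
    simp
    constructor
    · intro h
      have : p.lam * ((e 1 : ℂ) + 1 - e 2) = 0 := by linear_combination -h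
      have h2 := (mul_eq_zero.1 this).resolve_left hl
      have h3 : (e 1 + 1 : ℂ) = e 2 := by linear_combination h2
      exact_mod_cast h3.symm
    · intro h
      rw [h]
      push_cast
      ring

/-- The difference equals e₀ + n(a₁ + a₂). For n = 0 it vanishes only at yᵢ itself; for n > 0 its
vanishing would make a₁ + a₂ = -e₀/n a nonpositive rational. -/
theorem sum_residue_ne (p : Parameters) {i : Fin 3} (hi : i ≠ 0) {e : Fin 3 →₀ ℕ} {n : ℕ}
    (h1 : e 1 = (resonantExponent n + Finsupp.single i 1 : Fin 3 →₀ ℕ) 1)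
    (h2 : e 2 = (resonantExponent n + Finsupp.single i 1 : Fin 3 →₀ ℕ) 2) (he : e ≠ Finsupp.single i 1) :
    ∑ k, p.residue k * e k - p.residue i ≠ 0 := by
  have hsum : ∑ k, p.residue k * e k - p.residue i = e 0 + n * (p.a₁ + p.a₂) := by
    rw [Fin.sum_univ_three, h1, h2]
    fin_cases i
    · exact absurd rfl hi
    · simp [Parameters.residue, resonantExponent]
      ring
    · simp [Parameters.residue, resonantExponent]
      ring
  rw [hsum]
  intro h0
  by_cases hn : n = 0
  · subst hn
    apply he
    have : e 0 = 0 := by simpa using h0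
    ext k
    fin_cases k
    · simpa [hi] using this
    · simpa [resonantExponent] using h1
    · simpa [resonantExponent] using h2
  · have hn' : (n : ℂ) ≠ 0 := Nat.cast_ne_zero.2 hn
    refine p.nondegenerate (-(e 0 : ℚ) / n) ?_ ?_
    · rw [neg_div]
      exact neg_nonpos.2 (by positivity)
    · push_cast
      field_simp
      linear_combination h0

/-! ### Remainder and homological equation -/

/-- The coefficient of the linear term of index `i` in the component of index `i`. -/
def multiplier (Φ : FormalMap) (i : Fin 3) : ℂ := coeff (Finsupp.single i 1) (Φ i)

/-- The deviation of the component of index `i` from a diagonal linear map. -/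
def remainder (Φ : FormalMap) (i : Fin 3) : Series := Φ i - C (multiplier Φ i) * X i

theorem eq_remainder_add (Φ : FormalMap) (i : Fin 3) :
    Φ i = remainder Φ i + C (multiplier Φ i) * X i := (sub_add_cancel _ _).symm

theorem coeff_single_remainder (Φ : FormalMap) (i : Fin 3) :
    coeff (Finsupp.single i 1) (remainder Φ i) = 0 := by
  rw [remainder, map_sub, coeff_C_mul, coeff_index_single_self_X, mul_one, multiplier, sub_self]

theorem remainder_mem_yFiltration_one (h : IsSymmetry p Φ) {i : Fin 3} (hi : i ≠ 0) :
    remainder Φ i ∈ yFiltration 1 :=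
  sub_mem (h.mem_yFiltration_one hi) (Ideal.mul_mem_left _ _ (X_mem_yFiltration hi))

/-- The product of the multipliers of the `y`-components. -/
def theta (Φ : FormalMap) : ℂ := multiplier Φ 1 * multiplier Φ 2

theorem mul_sub_mem_yFiltration (h : IsSymmetry p Φ) {j : ℕ}
    (h1 : remainder Φ 1 ∈ yFiltration j) (h2 : remainder Φ 2 ∈ yFiltration j) :
    Φ 1 * Φ 2 - C (theta Φ) * (X 1 * X 2) ∈ yFiltration (j + 1) := by
  have : Φ 1 * Φ 2 - C (theta Φ) * (X 1 * X 2) =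
      remainder Φ 1 * (C (multiplier Φ 2) * X 2) + remainder Φ 2 * Φ 1 := by
    rw [theta, map_mul, remainder, remainder]
    ring
  rw [this]
  exact add_mem
    (mul_mem_yFiltration h1 (Ideal.mul_mem_left _ _ (X_mem_yFiltration (by decide))))
    (mul_mem_yFiltration h2 (h.mem_yFiltration_one (by decide)))

/-- The homological equation for the remainder. -/
theorem homological_equation (h : IsSymmetry p Φ) {j : ℕ} (i : Fin 3)
    (h1 : remainder Φ 1 ∈ yFiltration j) (h2 : remainder Φ 2 ∈ yFiltration j)
    (hi : remainder Φ i ∈ yFiltration j) :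
    diagonalDerivation p.eigenvalue (remainder Φ i) - C (p.eigenvalue i) * remainder Φ i +
        X 0 * (diagonalDerivation p.residue (remainder Φ i) -
          C (p.residue i) * remainder Φ i) -
        C (multiplier Φ i) * (X i *
          (PowerSeries.subst (C (theta Φ) * (X 1 * X 2) : Series) (p.nonlinear i) -
            PowerSeries.subst (C 1 * (X 1 * X 2) : Series) (p.nonlinear i))) ∈
      yFiltration (j + 1) := by
  have hsub := subst_sub_subst_mem_yFiltration (constantCoeff_mul Φ)
    (constantCoeff_C_mul_X_mul_X (theta Φ)) (p.nonlinear i) (h.mul_sub_mem_yFiltration h1 h2)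
  have hlin : PowerSeries.subst (C (theta Φ) * (X 1 * X 2) : Series) (p.nonlinear i) *
      remainder Φ i ∈ yFiltration (j + 1) := by
    rw [add_comm]
    exact mul_mem_yFiltration (subst_mem_yFiltration (by simp) (p.constantCoeff_nonlinear i)
      (Ideal.mul_mem_left _ _ (Ideal.mul_mem_left _ _ (X_mem_yFiltration (by decide))))) hi
  have hnon := sum_subst_mul_mem_yFiltration p hi
  have heq := h.equation i
  have hsumX : ∑ k, PowerSeries.subst (X 1 * X 2 : Series) (p.nonlinear k) *
      (X k * pderiv ℂ k (Φ i)) =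
      ∑ k, PowerSeries.subst (X 1 * X 2 : Series) (p.nonlinear k) *
        (X k * pderiv ℂ k (remainder Φ i)) + C (multiplier Φ i) *
        (X i * PowerSeries.subst (X 1 * X 2 : Series) (p.nonlinear i)) := by
    have hd : ∀ k, pderiv ℂ k (Φ i) = pderiv ℂ k (remainder Φ i) +
        C (multiplier Φ i) * pderiv ℂ k (X i) := fun k => by
      conv_lhs => rw [eq_remainder_add Φ i, map_add, pderiv_C_mul]
    have hs : ∑ k, PowerSeries.subst (X 1 * X 2 : Series) (p.nonlinear k) *
        (X k * (C (multiplier Φ i) * pderiv ℂ k (X i))) = C (multiplier Φ i) *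
        (X i * PowerSeries.subst (X 1 * X 2 : Series) (p.nonlinear i)) := by
      rw [Finset.sum_eq_single i, pderiv_X_self]
      · ring
      · intro k _ hk
        rw [pderiv_X_of_ne hk.symm, mul_zero, mul_zero, mul_zero]
      · simp
    rw [← hs, ← Finset.sum_add_distrib]
    refine Finset.sum_congr rfl fun k _ => ?_
    rw [hd]
    ring
  rw [sum_pderiv_mul_normalForm, hsumX] at heq
  have hA := diagonalDerivation_add_C_mul p.eigenvalue (multiplier Φ i) (remainder Φ i) (X i)
  have hB := diagonalDerivation_add_C_mul p.residue (multiplier Φ i) (remainder Φ i) (X i)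
  rw [← eq_remainder_add, diagonalDerivation_X] at hA hB
  rw [hA, hB, Parameters.logComponent] at heq
  -- The discarded terms are (cᵢ(Φ₁Φ₂) - cᵢ(θv))Φᵢ, cᵢ(θv)Rᵢ and ∑ cₖ(v) zₖ∂Rᵢ/∂zₖ, all of y-degree
  -- at least j + 1.
  have hfin := sub_mem (add_mem (Ideal.mul_mem_right (Φ i) _ hsub) hlin) hnon
  convert hfin using 1
  rw [map_one, one_mul]
  have hr := eq_remainder_add Φ i
  linear_combination heq + (C (p.eigenvalue i) + C (p.residue i) * X 0 +
    PowerSeries.subst (C (theta Φ) * (X 1 * X 2) : Series) (p.nonlinear i)) * hr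

/-- Only the monomials (y₁y₂)ⁿyᵢ, free of x, occur in yᵢc(t y₁y₂). Used with t = θ and t = 1, it
shows which coefficients of the homological equation have no source term. -/
theorem coeff_X_mul_subst_eq_zero (t : ℂ) (c : PowerSeries ℂ) {i : Fin 3} (hi : i ≠ 0)
    {e : Fin 3 →₀ ℕ} (he : e 0 ≠ 0 ∨ ¬ ∃ n, e 1 = (resonantExponent n + Finsupp.single i 1 : Fin 3 →₀ ℕ) 1 ∧
        e 2 = (resonantExponent n + Finsupp.single i 1 : Fin 3 →₀ ℕ) 2) :
    coeff e (X i * PowerSeries.subst (C t * (X 1 * X 2) : Series) c) = 0 := by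
  by_cases h0 : e i = 0
  · exact coeff_X_mul_of_eq_zero h0 _
  · obtain ⟨e', rfl⟩ := exists_eq_add_single h0
    rw [coeff_X_mul_add]
    refine coeff_subst_eq_zero t c fun hc => ?_
    rcases he with he | he
    · exact he (by simp [hc.1, hi])
    · exact he ⟨e' 2, by simp [resonantExponent, hc.2], by simp [resonantExponent]⟩

/-- Nonresonant coefficients are killed by the eigenvalue part of the homological equation, resonant
ones by its residue part. -/
theorem remainder_mem_succ (h : IsSymmetry p Φ) {j : ℕ} {i : Fin 3} (hi0 : i ≠ 0)
    (h1 : remainder Φ 1 ∈ yFiltration j) (h2 : remainder Φ 2 ∈ yFiltration j)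
    (hi : remainder Φ i ∈ yFiltration j) : remainder Φ i ∈ yFiltration (j + 1) := by
  have hom := h.homological_equation i h1 h2 hi
  have hcoeff : ∀ e : Fin 3 →₀ ℕ, e 1 + e 2 < j + 1 →
      (e 0 ≠ 0 ∨ ¬ ∑ k, p.eigenvalue k * e k = p.eigenvalue i) →
      (∑ k, p.eigenvalue k * e k - p.eigenvalue i) * coeff e (remainder Φ i) +
        coeff e (X 0 * (diagonalDerivation p.residue (remainder Φ i) -
          C (p.residue i) * remainder Φ i)) = 0 := by
    intro e he hres
    rw [sum_eigenvalue_eq_iff p hi0] at hres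
    have := hom e he
    rw [map_sub, map_add, map_sub, coeff_diagonalDerivation, coeff_C_mul, coeff_C_mul,
      mul_sub (X i), map_sub, coeff_X_mul_subst_eq_zero _ _ hi0 hres, coeff_X_mul_subst_eq_zero _ _ hi0 hres]
      at this
    linear_combination this
  intro e he
  by_cases hres : ∑ k, p.eigenvalue k * e k = p.eigenvalue i
  · have hres' : ∑ k, p.eigenvalue k * ((e + Finsupp.single 0 1 : Fin 3 →₀ ℕ) k : ℕ) = p.eigenvalue i := by
      rw [← hres]
      simp [Fin.sum_univ_three, Parameters.eigenvalue]
    have := hcoeff (e + Finsupp.single 0 1) (by simpa using he) (Or.inl (by simp))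
    rw [hres', sub_self, zero_mul, zero_add, coeff_X_mul_add, map_sub, coeff_diagonalDerivation,
      coeff_C_mul, ← sub_mul] at this
    by_cases hs : e = Finsupp.single i 1
    · rw [hs, coeff_single_remainder]
    · obtain ⟨n, hn1, hn2⟩ := (sum_eigenvalue_eq_iff p hi0 e).1 hres
      exact (mul_eq_zero.1 this).resolve_left (sum_residue_ne p hi0 hn1 hn2 hs)
  -- Nonresonant case, by induction on the power of x: the residue part involves only the
  -- coefficient with one factor x fewer, which is again nonresonant.
  · obtain ⟨n, hn⟩ : ∃ n, e 0 = n := ⟨_, rfl⟩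
    induction n generalizing e with
    | zero =>
      have := hcoeff e he (Or.inr hres)
      rw [coeff_X_mul_of_eq_zero hn, add_zero] at this
      exact (mul_eq_zero.1 this).resolve_left (sub_ne_zero.2 hres)
    | succ n ih =>
      obtain ⟨e', rfl⟩ := exists_eq_add_single (i := 0) (e := e) (by omega)
      have hprev : coeff e' (remainder Φ i) = 0 := by
        refine ih e' (by simpa using he) ?_ (by simpa using hn)
        convert hres using 2
        simp [Fin.sum_univ_three, Parameters.eigenvalue]
      have := hcoeff _ he (Or.inr hres)
      rw [coeff_X_mul_add, map_sub, coeff_diagonalDerivation, coeff_C_mul, hprev, mul_zero,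
        mul_zero, sub_zero, add_zero] at this
      exact (mul_eq_zero.1 this).resolve_left (sub_ne_zero.2 hres)

/-- The induction treats both y-components at once, because they are coupled through Φ₁Φ₂. -/
theorem remainder_eq_zero (h : IsSymmetry p Φ) {i : Fin 3} (hi : i ≠ 0) : remainder Φ i = 0 := by
  have key : ∀ j : ℕ, ∀ i : Fin 3, i ≠ 0 → remainder Φ i ∈ yFiltration (j + 1) := by
    intro j
    induction j with
    | zero => exact fun i hi => h.remainder_mem_yFiltration_one hi
    | succ j ih =>
      exact fun i hi => h.remainder_mem_succ hi (ih 1 (by decide)) (ih 2 (by decide)) (ih i hi)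
  exact eq_zero_of_forall_mem_yFiltration fun j => yFiltration_anti (Nat.le_succ j) (key j i hi)

/-- The symmetries of the normal form are linear and diagonal. -/
theorem eq_C_mul_X (h : IsSymmetry p Φ) {i : Fin 3} (hi : i ≠ 0) :
    Φ i = C (multiplier Φ i) * X i := by
  rw [eq_remainder_add Φ i, h.remainder_eq_zero hi, zero_add]

end IsSymmetry

/-! ### Diagonal symmetries -/

theorem subst_C_mul_eq_iff (t : ℂ) (c : PowerSeries ℂ) :
    PowerSeries.subst (X 1 * X 2 : Series) c =
      PowerSeries.subst (C t * (X 1 * X 2) : Series) c ↔ PowerSeries.rescale t c = c := by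
  have h1 : PowerSeries.subst (X 1 * X 2 : Series) c =
      PowerSeries.subst (C 1 * (X 1 * X 2) : Series) c := by rw [map_one, one_mul]
  rw [h1, PowerSeries.ext_iff]
  simp only [PowerSeries.coeff_rescale]
  constructor
  · intro h n
    have := congrArg (coeff (resonantExponent n)) h
    rw [coeff_subst_resonant, coeff_subst_resonant, one_pow, mul_one] at this
    rw [mul_comm, ← this]
  · intro h
    ext e
    rw [PowerSeries.coeff_subst (.of_constantCoeff_zero (constantCoeff_C_mul_X_mul_X 1)),
      PowerSeries.coeff_subst (.of_constantCoeff_zero (constantCoeff_C_mul_X_mul_X t))]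
    refine finsum_congr fun n => ?_
    rw [pow_eq_monomial, pow_eq_monomial, coeff_monomial, coeff_monomial]
    split_ifs
    · rw [one_pow, smul_eq_mul, smul_eq_mul, mul_one, mul_comm, h n]
    · rfl

/-- A diagonal linear map preserves the normal form if and only if it preserves its nonlinear
parts. -/
theorem equation_diag_iff (p : Parameters) (i : Fin 3) {a : ℂ} (ha : a ≠ 0) (t : ℂ) :
    ∑ j, pderiv ℂ j (C a * X i) * normalForm p j =
        p.logComponent i (X 0) (C t * (X 1 * X 2)) * (C a * X i) ↔
      PowerSeries.rescale t (p.nonlinear i) = p.nonlinear i := by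
  have hsum : ∑ j, pderiv ℂ j (C a * X i) * normalForm p j =
      p.logComponent i (X 0) (X 1 * X 2) * (C a * X i) := by
    rw [Finset.sum_eq_single i, pderiv_C_mul, pderiv_X_self, p.normalForm_apply]
    · ring
    · intro k _ hk
      rw [pderiv_C_mul, pderiv_X_of_ne hk.symm, mul_zero, zero_mul]
    · simp
  have hne : (C a * X i : Series) ≠ 0 := by
    rw [← smul_eq_C_mul]
    intro h
    have := congrArg (coeff (Finsupp.single i 1)) h
    simp [coeff_index_single_self_X] at this
    exact ha this
  rw [hsum, mul_left_inj' hne, Parameters.logComponent, Parameters.logComponent, add_right_inj,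
    subst_C_mul_eq_iff]

theorem isSymmetry_diag_iff (p : Parameters) (θ₁ θ₂ : ℂˣ) :
    IsSymmetry p (diag θ₁ θ₂ : FormalMap) ↔
      PowerSeries.rescale ((θ₁ : ℂ) * (θ₂ : ℂ)) p.c₁ = p.c₁ ∧
        PowerSeries.rescale ((θ₁ : ℂ) * (θ₂ : ℂ)) p.c₂ = p.c₂ := by
  -- The factor 1 lets `equation_diag_iff` cover the x-component too, where the nonlinear part is 0.
  have h0 : (diag θ₁ θ₂ : FormalMap) 0 = C 1 * X 0 := by simp [diag_apply]
  have h1 : (diag θ₁ θ₂ : FormalMap) 1 = C (θ₁ : ℂ) * X 1 := by simp [diag_apply]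
  have h2 : (diag θ₁ θ₂ : FormalMap) 2 = C (θ₂ : ℂ) * X 2 := by simp [diag_apply]
  have hprod : (diag θ₁ θ₂ : FormalMap) 1 * (diag θ₁ θ₂ : FormalMap) 2 =
      C ((θ₁ : ℂ) * (θ₂ : ℂ)) * (X 1 * X 2) := by
    rw [h1, h2, map_mul]
    ring
  have e1 := equation_diag_iff p 1 θ₁.ne_zero (θ₁ * θ₂ : ℂ)
  have e2 := equation_diag_iff p 2 θ₂.ne_zero (θ₁ * θ₂ : ℂ)
  rw [← h1, ← hprod] at e1
  rw [← h2, ← hprod] at e2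
  constructor
  · exact fun h => ⟨e1.1 (h.equation 1), e2.1 (h.equation 2)⟩
  · intro h
    refine ⟨by rw [h0, map_one, one_mul], Fin.forall_fin_succ.2 ⟨?_, Fin.forall_fin_two.2
      ⟨e1.2 h.1, e2.2 h.2⟩⟩⟩
    rw [h0, hprod]
    exact (equation_diag_iff p 0 one_ne_zero _).2 (map_zero _)

/-- The Jacobian determinant of a symmetry is the product of its two multipliers, so invertibility
makes both nonzero. -/
theorem exists_eq_diag (p : Parameters) (Φ : FormalDiffeo) (h : IsSymmetry p (Φ : FormalMap)) :
    ∃ θ₁ θ₂ : ℂˣ, Φ = diag θ₁ θ₂ := by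
  have h1 := h.eq_C_mul_X (i := 1) (by decide)
  have h2 := h.eq_C_mul_X (i := 2) (by decide)
  have hdet := ((FormalMap.isUnit_iff (Φ : FormalMap)).1 Φ.isUnit).map Matrix.detMonoidHom
  have hlin : (Φ : FormalMap).linearPart = Matrix.diagonal
      ![1, IsSymmetry.multiplier Φ 1, IsSymmetry.multiplier Φ 2] := by
    ext i j
    rw [FormalMap.linearPart_apply]
    fin_cases i
    · change coeff _ ((Φ : FormalMap) 0) = _
      rw [h.fibered, coeff_index_single_X]
      fin_cases j <;> simp
    · change coeff _ ((Φ : FormalMap) 1) = _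
      rw [h1, coeff_C_mul, coeff_index_single_X]
      fin_cases j <;> simp
    · change coeff _ ((Φ : FormalMap) 2) = _
      rw [h2, coeff_C_mul, coeff_index_single_X]
      fin_cases j <;> simp
  rw [hlin, Matrix.coe_detMonoidHom, Matrix.det_diagonal, Fin.prod_univ_three] at hdet
  simp [isUnit_iff_ne_zero] at hdet
  refine ⟨Units.mk0 _ hdet.1, Units.mk0 _ hdet.2, Units.ext (FormalMap.ext (funext fun i => ?_))⟩
  rw [diag_apply]
  fin_cases i
  · exact h.fibered
  · exact h1
  · exact h2

end DoublyResonant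

end

theorem mainTheorem6 (p : DoublyResonant.Parameters) :
    DoublyResonant.fiberedIsotropy (DoublyResonant.normalForm p) =
      {Φ : DoublyResonant.FormalDiffeo | ∃ θ₁ θ₂ : ℂˣ, Φ = DoublyResonant.diag θ₁ θ₂ ∧
        PowerSeries.rescale ((θ₁ : ℂ) * (θ₂ : ℂ)) p.c₁ = p.c₁ ∧
        PowerSeries.rescale ((θ₁ : ℂ) * (θ₂ : ℂ)) p.c₂ = p.c₂} := by
  ext Φ
  rw [DoublyResonant.mem_fiberedIsotropy_iff, Set.mem_ofPred_eq]
  constructor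
  · intro h
    obtain ⟨θ₁, θ₂, rfl⟩ := DoublyResonant.exists_eq_diag p Φ h
    exact ⟨θ₁, θ₂, rfl, (DoublyResonant.isSymmetry_diag_iff p θ₁ θ₂).1 h⟩
  · rintro ⟨θ₁, θ₂, rfl, h⟩
    exact (DoublyResonant.isSymmetry_diag_iff p θ₁ θ₂).2 h
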